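/- Let $N\ge 2$ and work in the polynomial ring $\mathbb{C}[x_1,\ldots,x_N]$, on which the symmetric group $S_N$ acts by permuting the variables. For a partition $\nu=(\nu_1\ge\cdots\ge\nu_k)$ of $N$ let $B_j=\{\nu_1+\cdots+\nu_{j-1}+1,\ldots,\nu_1+\cdots+\nu_j\}$ be its consecutive blocks of indices $(1\le j\le k)$, and for $T\subseteq\{1,\ldots,k\}$ put $$p_{\nu,T}(x)=\prod_{j=1}^{k}\ \prod_{\substack{i<i'\\ i,i'\in B_j}}(x_i^2-x_{i'}^2)\cdot\prod_{j\in T}\prod_{i\in B_j}x_i .$$ For $1\le k<N$ and $0\le m\le k$, write $N=kq+t$ with $0\le t<k$, let $\nu=((q+1)^{t},q^{k-t})$ and $T=\{k-m+1,\ldots,k\}$ (the last $m$ labels), and let $K_{k,m}$ be the ideal of $\mathbb{C}[x_1,\ldots,x_N]$ generated by all $S_N$-images of $p_{\nu,T}$. **Theorem.** Let $r,s$ be integers with $2\le r\le N$ and $0\le s\le r-1$. Then for every $f\in K_{r-1,\,r-s-1}$ the function $$g(x)=\frac{f(x)}{\prod_{1\le i<j\le N}(x_i^2-x_j^2)^{1/r}\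 \prod_{i=1}^N x_i^{\frac12-\frac sr}}$$ is locally $L^2$-integrable on $\mathbb{R}^N$, i.e. every point of $\mathbb{R}^N$ has a neighbourhood on which $|g|^2$ has finite integral with respect to Lebesgue measure. (Powers of negative reals are principal complex powers; only $|g|$ matters, so the choice of branch is irrelevant, and $g$ is defined off a set of measure zero.) -/

import Mathlib

open MeasureTheory Topology

noncomputable section

/-- The `j`-th block of consecutive indices determined by the sizes `ν 0, …, ν (k-1)`.
Indices are numbered from `0`, so this is
`{i | ν 0 + ⋯ + ν (j-1) ≤ i < ν 0 + ⋯ + ν j}`. -/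
def blockOf (N : ℕ) {k : ℕ} (ν : Fin k → ℕ) (j : Fin k) : Finset (Fin N) :=
  Finset.univ.filter fun i =>
    ∑ l ∈ Finset.Iio j, ν l ≤ (i : ℕ) ∧ (i : ℕ) < ∑ l ∈ Finset.Iic j, ν l

/-- The Vandermonde product `∏_{i < j} (x_i - x_j)` over the indices in `B`. -/
def vandermondeOn {N : ℕ} (B : Finset (Fin N)) : MvPolynomial (Fin N) ℂ :=
  ∏ i ∈ B, ∏ j ∈ B with i < j, (MvPolynomial.X i - MvPolynomial.X j)

/-- The polynomial `p_ν`: the product of the Vandermonde products of the blocks of `ν`. -/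
def pPoly (N : ℕ) {k : ℕ} (ν : Fin k → ℕ) : MvPolynomial (Fin N) ℂ :=
  ∏ j, vandermondeOn (blockOf N ν j)

/-- The polynomial `p_{ν,T}(x) = p_ν(x_1^2, …, x_N^2) ∏_{j ∈ T} ∏_{i in block j} x_i`. -/
def pPolyB (N : ℕ) {k : ℕ} (ν : Fin k → ℕ) (T : Finset (Fin k)) : MvPolynomial (Fin N) ℂ :=
  MvPolynomial.bind₁ (fun i => MvPolynomial.X i ^ 2) (pPoly N ν) *
    ∏ j ∈ T, ∏ i ∈ blockOf N ν j, MvPolynomial.X i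

/-- The ideal `K_{ν,T}` of `ℂ[x_1, …, x_N]` generated by all images of `p_{ν,T}` under
permutations of the variables. -/
def idealOfPartition (N : ℕ) {k : ℕ} (ν : Fin k → ℕ) (T : Finset (Fin k)) :
    Ideal (MvPolynomial (Fin N) ℂ) :=
  Ideal.span (Set.range fun σ : Equiv.Perm (Fin N) => MvPolynomial.rename σ (pPolyB N ν T))

/-- The partition `((q+1)^t, q^{k-t})` of `N = k q + t`, `0 ≤ t < k`. -/
def balancedPartition (N k : ℕ) : Fin k → ℕ :=
  fun j => if (j : ℕ) < N % k then N / k + 1 else N / k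

/-- The set of the last `s` among the `k` block labels. -/
def lastLabels (k s : ℕ) : Finset (Fin k) :=
  Finset.univ.filter fun j => k ≤ (j : ℕ) + s

/-- The ideal `K_{k,s}` of `ℂ[x_1, …, x_N]`. -/
def idealK (N k s : ℕ) : Ideal (MvPolynomial (Fin N) ℂ) :=
  idealOfPartition N (balancedPartition N k) (lastLabels k s)

/-- `f / (∏_{i<j} (x_i^2 - x_j^2)^a ∏_i x_i^b)` as a complex function on `ℝ^N`; powers are
principal complex powers (the choice of branch does not affect the modulus, and the function is
meaningful off the hyperplanes `x_i = ± x_j`, `x_i = 0`, which have measure zero). -/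
def quotientB {N : ℕ} (f : MvPolynomial (Fin N) ℂ) (a b : ℝ) (x : Fin N → ℝ) : ℂ :=
  MvPolynomial.eval (fun i => (x i : ℂ)) f /
    ((∏ i, ∏ j with i < j, ((x i : ℂ) ^ 2 - (x j : ℂ) ^ 2) ^ (a : ℂ)) *
      ∏ i, (x i : ℂ) ^ (b : ℂ))

/-- Local square-integrability on `ℝ^N` with respect to Lebesgue measure: every point has a
neighbourhood on which the function is measurable (almost everywhere) and square-integrable. -/
def LocallyL2 {N : ℕ} (g : (Fin N → ℝ) → ℂ) : Prop :=
  ∀ x : Fin N → ℝ, ∃ U ∈ 𝓝 x, MemLp g 2 (volume.restrict U)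

end

/-! Local square-integrability survives sums and multiplication by polynomials, so only the
generators of the ideal matter. For a generator, `|g|^2` is exactly a product of real powers of the
absolute values of the linear forms `x_i - x_j`, `x_i + x_j`, `x_i`, with exponents read off from
the colouring of indices by blocks.

Such a product is locally integrable as soon as every nonzero subspace `W` of the dual space
satisfies `dim W + (sum of the exponents of the forms in W) > 0`
(`exists_nhds_lintegral_linearFormsWeight_lt_top`). This is power counting: dilating transversally
to the common zero set of the forms turns the integral near that set into a geometric series, and
away from it fewer forms vanish, so induction applies.

To verify the criterion (`exponents_pos`), group indices by `x_i = ± x_j` modulo `W`. The indices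
with `x_i ∈ W` form at most one class `Z`, and `dim W` is at least `|Z|` plus the sum of `|A| - 1`
over the other classes `A`. The inequality thus splits over classes, and on each it becomes a
quadratic inequality in the integer colour counts, with `r - 1` colours (`sum_mul_pred_bound`,
`sum_mul_pred_add_sum_bound`). -/

/-! ### Local integrability of products of powers of linear forms -/

/-- Project along `V` onto a complement: the map `id - P + t • P` fixes `V` and scales the
complement by `t`. It supplies the dilations transverse to the common zero set of the forms. -/
theorem exists_projection_det_dilation {E : Type*} [NormedAddCommGroup E] [NormedSpace ℝ E]
    [FiniteDimensional ℝ E] (V : Submodule ℝ E) :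
    ∃ P : E →L[ℝ] E, (∀ x, P (P x) = P x) ∧ (∀ x, P x = 0 ↔ x ∈ V) ∧
      ∀ t : ℝ, (ContinuousLinearMap.id ℝ E - P + t • P).det =
        t ^ (Module.finrank ℝ E - Module.finrank ℝ V) := by
  obtain ⟨C, hC⟩ := Submodule.exists_isCompl V
  set e := Submodule.prodEquivOfIsCompl V C hC with he
  set P₀ : E →ₗ[ℝ] E := e.toLinearMap ∘ₗ LinearMap.prodMap 0 LinearMap.id ∘ₗ e.symm.toLinearMap
    with hP₀
  have hPe : ∀ y, P₀ (e y) = e (0, y.2) := fun y => by simp [hP₀]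
  refine ⟨LinearMap.toContinuousLinearMap P₀, fun x => ?_, fun x => ?_, fun t => ?_⟩
  · obtain ⟨y, rfl⟩ := e.surjective x
    simp [hPe]
  · obtain ⟨y, rfl⟩ := e.surjective x
    obtain ⟨v, c⟩ := y
    simp only [LinearMap.coe_toContinuousLinearMap', hPe, EmbeddingLike.map_eq_zero_iff]
    rw [he]
    simp only [Submodule.coe_prodEquivOfIsCompl', Prod.mk_eq_zero, true_and]
    constructor
    · rintro rfl
      simp
    · intro h
      have hc : (c : E) ∈ V := by simpa using V.sub_mem h v.2
      have := Submodule.disjoint_def.1 hC.disjoint _ hc c.2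
      exact_mod_cast this
  · have h1 : ((ContinuousLinearMap.id ℝ E - LinearMap.toContinuousLinearMap P₀ +
        t • LinearMap.toContinuousLinearMap P₀ : E →L[ℝ] E) : E →ₗ[ℝ] E) =
        e.toLinearMap ∘ₗ LinearMap.prodMap LinearMap.id (t • LinearMap.id) ∘ₗ
          e.symm.toLinearMap := by
      ext x
      obtain ⟨y, rfl⟩ := e.surjective x
      obtain ⟨v, c⟩ := y
      have h2 : ((v, c) : V × C) - (0, c) + t • (0, c) = (v, t • c) := by ext <;> simp
      have h3 : e (v, c) - P₀ (e (v, c)) + t • P₀ (e (v, c)) = e (v, t • c) := by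
        rw [hPe, ← map_smul, ← map_sub, ← map_add, h2]
      simpa using h3
    rw [ContinuousLinearMap.det, h1, LinearMap.det_conj, LinearMap.det_prodMap]
    have := Submodule.finrank_add_eq_of_isCompl hC
    simp only [LinearMap.det_id, LinearMap.det_smul, one_mul, mul_one]
    congr 1
    omega

theorem lintegral_lt_top_of_isCompact {X : Type*} [TopologicalSpace X] [MeasurableSpace X]
    {μ : Measure X} {f : X → ENNReal} {K : Set X} (hK : IsCompact K)
    (h : ∀ x ∈ K, ∃ U ∈ 𝓝 x, ∫⁻ y in U, f y ∂μ < ⊤) : ∫⁻ y in K, f y ∂μ < ⊤ := by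
  refine hK.induction_on (p := fun s => ∫⁻ y in s, f y ∂μ < ⊤) (by simp)
    (fun s t hst ht => (lintegral_mono_set hst).trans_lt ht)
    (fun s t hs ht => (lintegral_union_le _ _ _).trans_lt (ENNReal.add_lt_top.2 ⟨hs, ht⟩))
    fun x hx => ?_
  obtain ⟨U, hU, hfin⟩ := h x hx
  exact ⟨U, mem_nhdsWithin_of_mem_nhds hU, hfin⟩

/-- The product over `S` of real powers of absolute values of linear forms. -/
noncomputable def linearFormsWeight {E H : Type*} [AddCommGroup E] [Module ℝ E] (ℓ : H → Module.Dual ℝ E)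
    (a : H → ℝ) (S : Finset H) (x : E) : ℝ :=
  ∏ h ∈ S, |ℓ h x| ^ a h

section Arrangement

variable {E H : Type*} [NormedAddCommGroup E] [NormedSpace ℝ E] [FiniteDimensional ℝ E]
  [MeasurableSpace E] [BorelSpace E] {μ : Measure E}
  {ℓ : H → Module.Dual ℝ E} {a : H → ℝ}

theorem linearFormsWeight_nonneg {E H : Type*} [AddCommGroup E] [Module ℝ E]
    {ℓ : H → Module.Dual ℝ E} {a : H → ℝ} (S : Finset H) (x : E) : 0 ≤ linearFormsWeight ℓ a S x :=
  Finset.prod_nonneg fun _ _ => Real.rpow_nonneg (abs_nonneg _) _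

/-- Near `p` only the forms vanishing at `p` matter. -/
theorem exists_nhds_lintegral_linearFormsWeight_lt_top_of_filter [DecidableEq H] (S : Finset H)
    (p : E) [DecidablePred fun h => ℓ h p = 0]
    (hS : ∃ U ∈ 𝓝 p, ∫⁻ x in U,
      ENNReal.ofReal (linearFormsWeight ℓ a (S.filter fun h => ℓ h p = 0) x) ∂μ < ⊤) :
    ∃ U ∈ 𝓝 p, ∫⁻ x in U, ENNReal.ofReal (linearFormsWeight ℓ a S x) ∂μ < ⊤ := by
  obtain ⟨U, hU, hfin⟩ := hS
  set R := S.filter fun h => ¬ ℓ h p = 0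
  have hcont : ContinuousAt (linearFormsWeight ℓ a R) p := by
    refine tendsto_finsetProd _ fun h hh => ?_
    have hne : |ℓ h p| ≠ 0 := abs_ne_zero.2 (Finset.mem_filter.1 hh).2
    have hc : Continuous fun x => |ℓ h x| := (LinearMap.continuous_of_finiteDimensional _).abs
    exact (hc.continuousAt (x := p)).rpow_const (Or.inl hne)
  have hbd : ∀ᶠ x in 𝓝 p, linearFormsWeight ℓ a R x < linearFormsWeight ℓ a R p + 1 :=
    hcont.eventually_lt_const (lt_add_one _)
  set M := linearFormsWeight ℓ a R p + 1
  obtain ⟨W, hW, hWo, hpW⟩ := eventually_nhds_iff.1 hbd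
  refine ⟨U ∩ W, Filter.inter_mem hU (hWo.mem_nhds hpW), ?_⟩
  calc ∫⁻ x in U ∩ W, ENNReal.ofReal (linearFormsWeight ℓ a S x) ∂μ
      ≤ ∫⁻ x in U ∩ W, ENNReal.ofReal M *
          ENNReal.ofReal (linearFormsWeight ℓ a (S.filter fun h => ℓ h p = 0) x) ∂μ := by
        rw [Set.inter_comm, ← Measure.restrict_restrict hWo.measurableSet]
        refine setLIntegral_mono' hWo.measurableSet fun x hx => ?_
        have hM : 0 ≤ M := (linearFormsWeight_nonneg R x).trans (hW x hx).le
        rw [← ENNReal.ofReal_mul hM]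
        apply ENNReal.ofReal_le_ofReal
        rw [linearFormsWeight, ← Finset.prod_filter_mul_prod_filter_not S (fun h => ℓ h p = 0),
          mul_comm]
        exact mul_le_mul_of_nonneg_right (hW x hx).le (linearFormsWeight_nonneg _ x)
    _ = ENNReal.ofReal M * ∫⁻ x in U ∩ W,
          ENNReal.ofReal (linearFormsWeight ℓ a (S.filter fun h => ℓ h p = 0) x) ∂μ :=
        lintegral_const_mul' _ _ ENNReal.ofReal_ne_top
    _ < ⊤ := ENNReal.mul_lt_top ENNReal.ofReal_lt_top
        ((lintegral_mono_set Set.inter_subset_left).trans_lt hfin)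

/-- A homogeneous weight is integrable near `0` as soon as it is locally integrable off the common
zero set of the forms and the total degree exceeds minus the rank. -/
theorem exists_nhds_zero_lintegral_linearFormsWeight_lt_top [μ.IsAddHaarMeasure] (S : Finset H)
    (hS : Submodule.span ℝ (ℓ '' S) ≠ ⊥)
    (hdeg : 0 < (Module.finrank ℝ (Submodule.span ℝ (ℓ '' S)) : ℝ) + ∑ h ∈ S, a h)
    (hloc : ∀ p : E, (∃ h ∈ S, ℓ h p ≠ 0) →
      ∃ U ∈ 𝓝 p, ∫⁻ x in U, ENNReal.ofReal (linearFormsWeight ℓ a S x) ∂μ < ⊤) :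
    ∃ U ∈ 𝓝 (0 : E), ∫⁻ x in U, ENNReal.ofReal (linearFormsWeight ℓ a S x) ∂μ < ⊤ := by
  set W := Submodule.span ℝ (ℓ '' S) with hW
  set V := W.dualCoannihilator with hV
  have hVmem : ∀ x, x ∈ V ↔ ∀ h ∈ S, ℓ h x = 0 := by
    intro x
    rw [hV, Submodule.mem_dualCoannihilator]
    constructor
    · exact fun hx h hh => hx _ (Submodule.subset_span ⟨h, hh, rfl⟩)
    · intro hx φ hφ
      induction hφ using Submodule.span_induction with
      | mem y hy => obtain ⟨h, hh, rfl⟩ := hy; exact hx h hh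
      | zero => rfl
      | add y z _ _ hy hz => simp [hy, hz]
      | smul c y _ hy => simp [hy]
  have hrank : Module.finrank ℝ E - Module.finrank ℝ V = Module.finrank ℝ W := by
    have : Module.finrank ℝ W + Module.finrank ℝ V = Module.finrank ℝ E :=
      Subspace.finrank_add_finrank_dualCoannihilator_eq W
    omega
  have hWpos : Module.finrank ℝ W ≠ 0 := fun h => hS (Submodule.finrank_eq_zero.1 h)
  have hVtop : V ≠ ⊤ := by
    intro h
    rw [h, finrank_top] at hrank
    omega
  obtain ⟨P, hPP, hP0, hdet⟩ := exists_projection_det_dilation V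
  set F := linearFormsWeight ℓ a S with hF
  set δ : ℝ := Module.finrank ℝ W + ∑ h ∈ S, a h with hδ
  have hℓP : ∀ h ∈ S, ∀ x, ℓ h (P x) = ℓ h x := by
    intro h hh x
    have : x - P x ∈ V := (hP0 _).1 (by simp [hPP])
    have := (hVmem _).1 this h hh
    rw [map_sub, sub_eq_zero] at this
    exact this.symm
  set D : ℝ → E →L[ℝ] E := fun t => ContinuousLinearMap.id ℝ E - P + t • P with hD
  have hDapp : ∀ t x, D t x = x - P x + t • P x := fun t x => by simp [hD]
  have hPD : ∀ t x, P (D t x) = t • P x := fun t x => by simp [hDapp, hPP]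
  have hFD : ∀ t : ℝ, 0 < t → ∀ x, F (D t x) = t ^ (∑ h ∈ S, a h) * F x := by
    intro t ht x
    rw [hF, linearFormsWeight, linearFormsWeight, Real.rpow_sum_of_pos ht,
      ← Finset.prod_mul_distrib]
    refine Finset.prod_congr rfl fun h hh => ?_
    rw [hDapp, map_add, map_sub, map_smul, hℓP h hh, sub_self, zero_add, smul_eq_mul, abs_mul,
      abs_of_pos ht, Real.mul_rpow ht.le (abs_nonneg _)]
  set B : Set E := {x | ‖x - P x‖ ≤ 1 ∧ ‖P x‖ ≤ 1} with hB
  set A : Set E := {x | (‖x - P x‖ ≤ 1 ∧ ‖P x‖ ≤ 1) ∧ 1 / 2 ≤ ‖P x‖} with hA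
  have hAc : IsCompact A := by
    apply Metric.isCompact_of_isClosed_isBounded
    · have h1 : Continuous fun x => ‖x - P x‖ := by fun_prop
      have h2 : Continuous fun x => ‖P x‖ := by fun_prop
      exact ((isClosed_le h1 continuous_const).inter (isClosed_le h2 continuous_const)).inter
        (isClosed_le continuous_const h2)
    · refine (Metric.isBounded_closedBall (x := (0 : E)) (r := 2)).subset fun x hx => ?_
      have := norm_add_le (x - P x) (P x)
      rw [sub_add_cancel] at this
      rw [mem_closedBall_zero_iff]
      linarith [hx.1.1, hx.1.2]
  -- On the shell `A` the transverse part `P x` is nonzero, so some form is nonzero and `hloc`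
  -- applies at every point of a compact set.
  have hAfin : ∫⁻ x in A, ENNReal.ofReal (F x) ∂μ < ⊤ := by
    refine lintegral_lt_top_of_isCompact hAc fun x hx => hloc x ?_
    by_contra! hcon
    have : P x = 0 := (hP0 x).2 ((hVmem x).2 hcon)
    have h2 := hx.2
    rw [this, norm_zero] at h2
    norm_num at h2
  set I := ∫⁻ x in A, ENNReal.ofReal (F x) ∂μ with hI
  -- Dilating by `t` contributes the Jacobian `t ^ dim W` and the homogeneity factor `t ^ ∑ a`, that
  -- is `t ^ δ` in total; `q` is the ratio for `t = 1/2`, and `δ > 0` makes it less than `1`.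
  set q : ℝ := (1 / 2 : ℝ) ^ δ with hq
  have hq0 : 0 ≤ q := by positivity
  have hq1 : q < 1 := Real.rpow_lt_one (by norm_num) (by norm_num) hdeg
  have hshell : ∀ k : ℕ, ∫⁻ x in D ((1 / 2) ^ k) '' A, ENNReal.ofReal (F x) ∂μ =
      ENNReal.ofReal q ^ k * I := by
    intro k
    set t : ℝ := (1 / 2) ^ k with ht
    have htpos : 0 < t := by positivity
    rw [lintegral_image_eq_lintegral_abs_det_fderiv_mul μ hAc.measurableSet
      (f := D t) (f' := fun _ => D t) (fun x _ => (D t).hasFDerivWithinAt)]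
    · rw [← ENNReal.ofReal_pow hq0, hI, ← lintegral_const_mul' _ _ ENNReal.ofReal_ne_top]
      refine lintegral_congr fun x => ?_
      rw [hFD t htpos, ← ENNReal.ofReal_mul (abs_nonneg _), ← ENNReal.ofReal_mul (by positivity)]
      congr 1
      rw [hdet, hrank, abs_of_pos (by positivity), ← mul_assoc, ← Real.rpow_natCast,
        ← Real.rpow_add htpos, ht, hq, ← Real.rpow_natCast, ← Real.rpow_natCast,
        ← Real.rpow_mul (by norm_num), ← Real.rpow_mul (by norm_num), mul_comm δ]
    · intro x _ y _ hxy
      have h1 : t • P x = t • P y := by rw [← hPD, ← hPD, hxy]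
      have h2 : P x = P y := smul_right_injective _ htpos.ne' h1
      have h3 := hxy
      simp only [hDapp, h2] at h3
      simpa using h3
  -- Off the null set `V`, the box `B` is covered by the dyadic shells `2^{-(k+1)} ≤ ‖P x‖ ≤
  -- 2^{-k}`.
  have hcover : B ⊆ (V : Set E) ∪ ⋃ k : ℕ, D ((1 / 2) ^ k) '' A := by
    intro x hx
    by_cases hxV : x ∈ V
    · exact Or.inl hxV
    right
    have hPx : 0 < ‖P x‖ := norm_pos_iff.2 fun h => hxV ((hP0 x).1 h)
    obtain ⟨k, hk1, hk2⟩ := exists_nat_pow_near_of_lt_one hPx hx.2 (by norm_num : (0 : ℝ) < 1 / 2)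
      (by norm_num)
    rw [Set.mem_iUnion]
    have hkpos : (0 : ℝ) < (1 / 2) ^ k := by positivity
    have hPy : P (D ((1 / 2) ^ k)⁻¹ x) = ((1 / 2 : ℝ) ^ k)⁻¹ • P x := hPD _ _
    refine ⟨k, D ((1 / 2) ^ k)⁻¹ x, ⟨⟨?_, ?_⟩, ?_⟩, ?_⟩
    · rw [hPy, hDapp, add_sub_cancel_right]
      exact hx.1
    · rw [hPy, norm_smul, norm_inv, Real.norm_of_nonneg hkpos.le, inv_mul_le_iff₀ hkpos, mul_one]
      exact hk2
    · rw [hPy, norm_smul, norm_inv, Real.norm_of_nonneg hkpos.le, le_inv_mul_iff₀ hkpos]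
      rw [pow_succ] at hk1
      exact hk1.le
    · rw [hDapp, hPy, hDapp, smul_smul, mul_inv_cancel₀ hkpos.ne']
      simp
  refine ⟨B, ?_, ?_⟩
  · have h1 : ∀ᶠ x in 𝓝 (0 : E), ‖x - P x‖ < 1 := by
      have : Continuous fun x => ‖x - P x‖ := by fun_prop
      exact this.continuousAt.eventually_lt_const (by simp)
    have h2 : ∀ᶠ x in 𝓝 (0 : E), ‖P x‖ < 1 := by
      have : Continuous fun x => ‖P x‖ := by fun_prop
      exact this.continuousAt.eventually_lt_const (by simp)
    filter_upwards [h1, h2] with x hx1 hx2 using ⟨hx1.le, hx2.le⟩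
  · have hVzero : ∫⁻ x in (V : Set E), ENNReal.ofReal (F x) ∂μ = 0 :=
      setLIntegral_measure_zero _ _ (Measure.addHaar_submodule μ V hVtop)
    calc ∫⁻ x in B, ENNReal.ofReal (F x) ∂μ
        ≤ ∫⁻ x in (V : Set E) ∪ ⋃ k : ℕ, D ((1 / 2) ^ k) '' A, ENNReal.ofReal (F x) ∂μ :=
          lintegral_mono_set hcover
      _ ≤ 0 + ∑' k : ℕ, ENNReal.ofReal q ^ k * I := by
          refine (lintegral_union_le _ _ _).trans (add_le_add hVzero.le ?_)
          refine (lintegral_iUnion_le _ _).trans (ENNReal.tsum_le_tsum fun k => (hshell k).le)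
      _ < ⊤ := by
          rw [zero_add, ENNReal.tsum_mul_right, ENNReal.tsum_geometric]
          refine ENNReal.mul_lt_top (ENNReal.inv_lt_top.2 (tsub_pos_of_lt ?_)) hAfin
          exact ENNReal.ofReal_lt_one.2 hq1

/-- Local integrability of a product of powers of linear forms. -/
theorem exists_nhds_lintegral_linearFormsWeight_lt_top [μ.IsAddHaarMeasure] (hne : ∀ h, ℓ h = 0 → a h = 0)
    (S : Finset H)
    (hS : ∀ (W : Submodule ℝ (Module.Dual ℝ E)) [DecidablePred fun h => ℓ h ∈ W], W ≠ ⊥ →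
      0 < (Module.finrank ℝ W : ℝ) + ∑ h ∈ S with ℓ h ∈ W, a h) (p : E) :
    ∃ U ∈ 𝓝 p, ∫⁻ x in U, ENNReal.ofReal (linearFormsWeight ℓ a S x) ∂μ < ⊤ := by
  classical
  induction S using Finset.strongInduction generalizing p with
  | H S ih =>
    have hstep : ∀ p : E, (∃ h ∈ S, ℓ h p ≠ 0) →
        ∃ U ∈ 𝓝 p, ∫⁻ x in U, ENNReal.ofReal (linearFormsWeight ℓ a S x) ∂μ < ⊤ := by
      intro p hp
      apply exists_nhds_lintegral_linearFormsWeight_lt_top_of_filter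
      apply ih
      · obtain ⟨h, hh, hp⟩ := hp
        exact Finset.filter_ssubset.2 ⟨h, hh, hp⟩
      · intro W _ hW
        -- The forms of `W` surviving near `p` are those in `W'`, and `dim W' ≤ dim W`, so the
        -- criterion passes to the smaller family. If `W' = ⊥`, only zero forms remain, and their
        -- exponents vanish.
        set W' := W ⊓ LinearMap.ker (Module.Dual.eval ℝ E p) with hW'
        have hmem : ∀ h, ℓ h ∈ W' ↔ ℓ h p = 0 ∧ ℓ h ∈ W := by
          intro h
          rw [hW', Submodule.mem_inf, LinearMap.mem_ker, Module.Dual.eval_apply, and_comm]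
        have hsum : ∑ h ∈ (S.filter fun h => ℓ h p = 0) with ℓ h ∈ W, a h =
            ∑ h ∈ S with ℓ h ∈ W', a h := by
          rw [Finset.filter_filter]
          simp only [hmem]
        rw [hsum]
        by_cases hbot : W' = ⊥
        · have h0 : ∑ h ∈ S with ℓ h ∈ W', a h = 0 := by
            refine Finset.sum_eq_zero fun h hh => hne h ?_
            have := (Finset.mem_filter.1 hh).2
            rwa [hbot, Submodule.mem_bot] at this
          rw [h0, add_zero, Nat.cast_pos]
          exact Nat.pos_of_ne_zero fun h => hW (Submodule.finrank_eq_zero.1 h)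
        · refine (hS W' hbot).trans_le ?_
          gcongr
          exact Submodule.finrank_mono (inf_le_left (a := W))
    by_cases hp : ∃ h ∈ S, ℓ h p ≠ 0
    · exact hstep p hp
    push Not at hp
    by_cases hspan : Submodule.span ℝ (ℓ '' S) = ⊥
    · have hzero : ∀ h ∈ S, a h = 0 := fun h hh => hne h
        ((Submodule.mem_bot ℝ).1 (hspan ▸ Submodule.subset_span ⟨h, hh, rfl⟩))
      have hone : linearFormsWeight ℓ a S = fun _ => 1 := by
        ext x
        exact Finset.prod_eq_one fun h hh => by rw [hzero h hh, Real.rpow_zero]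
      refine ⟨Metric.ball p 1, Metric.ball_mem_nhds _ one_pos, ?_⟩
      simpa [hone] using measure_ball_lt_top
    · obtain ⟨U, hU, hfin⟩ := exists_nhds_zero_lintegral_linearFormsWeight_lt_top (μ := μ) S
        hspan (by
          have := hS _ hspan
          have hall : ∀ h ∈ S, ℓ h ∈ Submodule.span ℝ (ℓ '' S) :=
            fun h hh => Submodule.subset_span (Set.mem_image_of_mem ℓ hh)
          rwa [Finset.filter_true_of_mem hall] at this)
        hstep
      -- All forms vanish at `p`, so the weight is invariant under translation by `p` and the case
      -- of the origin suffices.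
      refine ⟨(fun x => x - p) ⁻¹' U, ?_, ?_⟩
      · have hc : ContinuousAt (fun x => x - p) p := by fun_prop
        exact hc.preimage_mem_nhds (by simpa using hU)
      · have hinv : ∀ x, linearFormsWeight ℓ a S x = linearFormsWeight ℓ a S (x - p) := by
          intro x
          refine Finset.prod_congr rfl fun h hh => ?_
          rw [map_sub, hp h hh, sub_zero]
        have hmp := measurePreserving_sub_right μ p
        have := hmp.setLIntegral_comp_preimage_emb
          (MeasurableEquiv.subRight p).measurableEmbedding
          (fun x => ENNReal.ofReal (linearFormsWeight ℓ a S x)) U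
        simp only [← hinv] at this
        rwa [this]

end Arrangement

/-! ### Quadratic inequalities for integer colour counts -/

/-- Termwise, `n(n-1) - 2ln + l(l+1) = (n-l)(n-l-1)`, which is nonnegative for integers. -/
theorem two_mul_sub_le_sum_mul_pred {ι : Type*} [Fintype ι] (n : ι → ℤ) (l : ℤ) :
    2 * l * ∑ c, n c - Fintype.card ι * (l * (l + 1)) ≤ ∑ c, n c * (n c - 1) := by
  have h : ∀ c, 2 * l * n c - l * (l + 1) ≤ n c * (n c - 1) := fun c => by
    rcases le_or_gt (n c) l with h | h <;> nlinarith
  calc 2 * l * ∑ c, n c - Fintype.card ι * (l * (l + 1))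
      = ∑ c, (2 * l * n c - l * (l + 1)) := by
        rw [Finset.sum_sub_distrib, Finset.mul_sum]
        simp
    _ ≤ _ := Finset.sum_le_sum fun c _ => h c

/-- Use the preceding minorant with `l = M / r`, the divisor being `r` although there are only `r -
1` colours. Writing `M = r l + d` leaves `r l (l+2) + (d-1)(r-d)`; its second term is negative only
for `d = 0`, where it is `-r`, and then `l ≥ 1`. -/
theorem sum_mul_pred_bound {ι : Type*} [Fintype ι] (n : ι → ℤ) {r : ℤ}
    (hr : (Fintype.card ι : ℤ) + 1 = r) (hn : 2 ≤ ∑ c, n c) :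
    0 < r * ∑ c, n c * (n c - 1) + (∑ c, n c - 1) * (r - ∑ c, n c) := by
  set M := ∑ c, n c
  have hr0 : 0 < r := by omega
  have h := two_mul_sub_le_sum_mul_pred n (M / r)
  have hd0 := Int.emod_nonneg M hr0.ne'
  have hd1 := Int.emod_lt_of_pos M hr0
  have hM := Int.emod_add_mul_ediv M r
  have hl : 0 ≤ M / r := Int.ediv_nonneg (by omega) hr0.le
  set l := M / r
  set d := M % r
  have hk : (Fintype.card ι : ℤ) = r - 1 := by omega
  rw [hk] at h
  have h2 := mul_le_mul_of_nonneg_left h hr0.le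
  have h3 : r * (2 * l * M - (r - 1) * (l * (l + 1))) + (M - 1) * (r - M) =
      r * l * (l + 2) + (d - 1) * (r - d) := by
    rw [← hM]; ring
  suffices 0 < r * l * (l + 2) + (d - 1) * (r - d) by linarith
  rcases hl.eq_or_lt with hl | hl
  · rw [← hl, mul_zero, add_zero] at hM
    rw [← hl]
    have : 0 < (d - 1) * (r - d) := mul_pos (by omega) (by omega)
    linarith
  · have h4 : r * 3 ≤ r * (l * (l + 2)) := mul_le_mul_of_nonneg_left (by nlinarith) hr0.le
    rcases hd0.eq_or_lt with hd | hd
    · rw [← hd]; linarith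
    · have : 0 ≤ (d - 1) * (r - d) := mul_nonneg (by omega) (by omega)
      linarith

/-- Colours in `T` contribute `n^2` and the others `n(n-1)`. Both are bounded below by lines of a
common slope, chosen by comparing the remainder `d` of `M` modulo `r` with `s`. -/
theorem sum_mul_pred_add_sum_bound {ι : Type*} [Fintype ι] [DecidableEq ι] (n : ι → ℤ)
    (T : Finset ι) {r s : ℤ} (hs : s + T.card = Fintype.card ι)
    (hr : (Fintype.card ι : ℤ) + 1 = r) (hs0 : 0 ≤ s) (hn : 1 ≤ ∑ c, n c) :
    0 < r * (∑ c, n c * (n c - 1) + ∑ c ∈ T, n c) - (∑ c, n c) * (∑ c, n c - 1 - s) := by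
  set M := ∑ c, n c with hMdef
  have hr0 : 0 < r := by omega
  have hTc : ((Tᶜ).card : ℤ) = s := by
    have := T.card_add_card_compl
    omega
  have hT : (T.card : ℤ) = r - 1 - s := by omega
  have hF : ∑ c, n c * (n c - 1) + ∑ c ∈ T, n c =
      ∑ c ∈ T, n c ^ 2 + ∑ c ∈ Tᶜ, n c * (n c - 1) := by
    rw [← Finset.sum_add_sum_compl T fun c => n c * (n c - 1), add_right_comm,
      ← Finset.sum_add_distrib]
    congr 1
    exact Finset.sum_congr rfl fun c _ => by ring
  have hMs : M = ∑ c ∈ T, n c + ∑ c ∈ Tᶜ, n c := (Finset.sum_add_sum_compl T n).symm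
  have key : ∀ x y z : ℤ, (∀ c, x * n c - y ≤ n c ^ 2) → (∀ c, x * n c - z ≤ n c * (n c - 1)) →
      x * M - (r - 1 - s) * y - s * z ≤ ∑ c, n c * (n c - 1) + ∑ c ∈ T, n c := by
    intro x y z hy hz
    rw [hF]
    have h1 := Finset.sum_le_sum fun c (_ : c ∈ T) => hy c
    have h2 := Finset.sum_le_sum fun c (_ : c ∈ Tᶜ) => hz c
    rw [Finset.sum_sub_distrib, ← Finset.mul_sum, Finset.sum_const, nsmul_eq_mul, hT] at h1
    rw [Finset.sum_sub_distrib, ← Finset.mul_sum, Finset.sum_const, nsmul_eq_mul, hTc] at h2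
    rw [hMs]
    linarith
  set F := ∑ c, n c * (n c - 1) + ∑ c ∈ T, n c
  have hd0 := Int.emod_nonneg M hr0.ne'
  have hd1 := Int.emod_lt_of_pos M hr0
  have hM := Int.emod_add_mul_ediv M r
  have hl : 0 ≤ M / r := Int.ediv_nonneg (by omega) hr0.le
  set l := M / r
  set d := M % r
  rcases le_or_gt d s with hds | hds
  -- Slope `2l`: tangent to `n^2` at `l`, secant to `n(n-1)` through `l` and `l+1`.
  · have h := key (2 * l) (l ^ 2) (l * (l + 1)) (fun c => by nlinarith [sq_nonneg (n c - l)])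
      fun c => by rcases le_or_gt (n c) l with h | h <;> nlinarith
    have h2 := mul_le_mul_of_nonneg_left h hr0.le
    have h3 : r * (2 * l * M - (r - 1 - s) * l ^ 2 - s * (l * (l + 1))) - M * (M - 1 - s) =
        d * (s + 1 - d) + r * (l * (l + 1)) := by
      rw [← hM]; ring
    suffices 0 < d * (s + 1 - d) + r * (l * (l + 1)) by linarith
    have h4 : 0 ≤ d * (s + 1 - d) := mul_nonneg hd0 (by omega)
    rcases hl.eq_or_lt with hl | hl
    · rw [← hl, mul_zero, add_zero] at hM
      have : 0 < d * (s + 1 - d) := mul_pos (by omega) (by omega)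
      rw [← hl]
      linarith
    · have : 0 < r * (l * (l + 1)) := by positivity
      linarith
  -- Slope `2l+1`: secant to `n^2` through `l` and `l+1`, tangent to `n(n-1)` at `l+1`.
  · have h := key (2 * l + 1) (l * (l + 1)) ((l + 1) ^ 2)
      (fun c => by rcases le_or_gt (n c) l with h | h <;> nlinarith)
      fun c => by nlinarith [sq_nonneg (n c - 1 - l)]
    have h2 := mul_le_mul_of_nonneg_left h hr0.le
    have h3 : r * ((2 * l + 1) * M - (r - 1 - s) * (l * (l + 1)) - s * (l + 1) ^ 2) -
        M * (M - 1 - s) = r * (l * (l + 2)) + (d - s) * (r - d) + d := by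
      rw [← hM]; ring
    suffices 0 < r * (l * (l + 2)) + (d - s) * (r - d) + d by linarith
    have h4 : 0 < (d - s) * (r - d) := mul_pos (by omega) (by omega)
    have h5 : 0 ≤ r * (l * (l + 2)) := by positivity
    linarith

/-! ### Exponents attached to a class of indices -/

/-- The exponent of `|x_i^2 - x_j^2|` attached to an ordered pair of indices with colours given
by `c`. -/
noncomputable def pairExponent {N : ℕ} {ι : Type*} [DecidableEq ι] (c : Fin N → ι) (r : ℕ)
    (i j : Fin N) : ℝ :=
  if i = j then 0 else (if c i = c j then 1 else 0) - 1 / r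

/-- The exponent of `|x_i|`. -/
noncomputable def coordExponent {N : ℕ} {ι : Type*} [DecidableEq ι] (c : Fin N → ι) (T : Finset ι)
    (r s : ℕ) (i : Fin N) : ℝ :=
  (if c i ∈ T then 2 else 0) - (1 - 2 * s / r)

section Exponents

variable {N : ℕ} {ι : Type*} [Fintype ι] [DecidableEq ι] (c : Fin N → ι) (T : Finset ι) {r s : ℕ}

theorem sum_card_filter_eq (A : Finset (Fin N)) :
    ∑ u, (A.filter fun i => c i = u).card = A.card :=
  (Finset.card_eq_sum_card_fiberwise fun _ _ => Finset.mem_univ _).symm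

theorem sum_sum_pairExponent (A : Finset (Fin N)) :
    ∑ i ∈ A, ∑ j ∈ A, pairExponent c r i j =
      ∑ u, ((A.filter fun i => c i = u).card : ℝ) * ((A.filter fun i => c i = u).card - 1) -
        A.card * (A.card - 1) / r := by
  have h1 : ∀ i j, pairExponent c r i j =
      (if c j = c i then 1 else 0) - 1 / r - if i = j then (1 - 1 / r : ℝ) else 0 := by
    intro i j
    by_cases h : i = j
    · simp [pairExponent, h]
    · simp [pairExponent, h, eq_comm]
  have h2 : ∀ i ∈ A, ∑ j ∈ A, pairExponent c r i j =
      ((A.filter fun j => c j = c i).card : ℝ) - A.card / r - (1 - 1 / r) := by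
    intro i hi
    simp only [h1, Finset.sum_sub_distrib, Finset.sum_ite_eq, hi, if_true]
    simp [div_eq_mul_inv]
  rw [Finset.sum_congr rfl h2, Finset.sum_sub_distrib, Finset.sum_sub_distrib,
    ← Finset.sum_fiberwise A c]
  have h3 : ∀ u, ∑ i ∈ A with c i = u, ((A.filter fun j => c j = c i).card : ℝ) =
      ((A.filter fun i => c i = u).card : ℝ) * (A.filter fun i => c i = u).card := by
    intro u
    rw [Finset.sum_congr rfl fun i hi => by rw [(Finset.mem_filter.1 hi).2], Finset.sum_const,
      nsmul_eq_mul]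
  have h4 : ((∑ u, (A.filter fun i => c i = u).card : ℕ) : ℝ) = A.card := by
    rw [sum_card_filter_eq]
  push_cast at h4
  simp only [h3, mul_sub, mul_one, Finset.sum_sub_distrib, h4, Finset.sum_const, nsmul_eq_mul]
  ring

omit [Fintype ι] in
theorem sum_coordExponent (A : Finset (Fin N)) :
    ∑ i ∈ A, coordExponent c T r s i =
      2 * ∑ u ∈ T, ((A.filter fun i => c i = u).card : ℝ) - A.card * (1 - 2 * s / r) := by
  simp only [coordExponent]
  rw [Finset.sum_sub_distrib, Finset.sum_const, nsmul_eq_mul]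
  congr 1
  rw [← Finset.sum_filter, Finset.sum_const, nsmul_eq_mul, mul_comm]
  congr 1
  rw [← Nat.cast_sum, Nat.cast_inj,
    Finset.card_eq_sum_card_fiberwise (f := c) (t := T) fun i hi => by simp_all]
  refine Finset.sum_congr rfl fun u hu => ?_
  rw [Finset.filter_filter]
  congr 1
  ext i
  simp only [Finset.mem_filter]
  constructor
  · rintro ⟨h, -, h'⟩; exact ⟨h, h'⟩
  · rintro ⟨h, h'⟩; exact ⟨h, h' ▸ hu, h'⟩

/-- After multiplication by `r` this is `sum_mul_pred_bound` for the colour counts of `A`; `|A| - 1`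
is the rank that a class outside `W` contributes. -/
theorem class_exponent_pos (hr : Fintype.card ι + 1 = r) (A : Finset (Fin N)) (hA : 2 ≤ A.card) :
    0 < ((A.card : ℝ) - 1) + ∑ i ∈ A, ∑ j ∈ A, pairExponent c r i j := by
  have hsum : ∑ u, ((A.filter fun i => c i = u).card : ℤ) = A.card := by
    exact_mod_cast sum_card_filter_eq c A
  have h := sum_mul_pred_bound (fun u => ((A.filter fun i => c i = u).card : ℤ)) (r := r)
    (by exact_mod_cast hr) (by rw [hsum]; exact_mod_cast hA)
  rw [hsum] at h
  have hR : (0 : ℝ) < r := by exact_mod_cast (by omega : 0 < r)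
  have h' := (Int.cast_pos (R := ℝ)).2 h
  push_cast at h'
  rw [sum_sum_pairExponent]
  refine pos_of_mul_pos_right (a := (r : ℝ)) ?_ hR.le
  convert h' using 1
  field_simp
  ring

/-- The rank `|A|` cancels against the `-1` in each `coordExponent`; what remains is `2 / r` times
the quantity in `sum_mul_pred_add_sum_bound`. The factor `2` on pairs reflects that both `x_i - x_j`
and `x_i + x_j` lie in `W`. -/
theorem zero_class_exponent_pos (hr : Fintype.card ι + 1 = r) (hs : s + T.card = Fintype.card ι)
    (A : Finset (Fin N)) (hA : A.Nonempty) :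
    0 < (A.card : ℝ) + 2 * ∑ i ∈ A, ∑ j ∈ A, pairExponent c r i j +
      ∑ i ∈ A, coordExponent c T r s i := by
  have hsum : ∑ u, ((A.filter fun i => c i = u).card : ℤ) = A.card := by
    exact_mod_cast sum_card_filter_eq c A
  have h := sum_mul_pred_add_sum_bound (fun u => ((A.filter fun i => c i = u).card : ℤ)) T
    (r := r) (s := s) (by exact_mod_cast hs) (by exact_mod_cast hr) (by positivity)
    (by rw [hsum]; exact_mod_cast hA.card_pos)
  rw [hsum] at h
  have hR : (0 : ℝ) < r := by exact_mod_cast (by omega : 0 < r)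
  have h' := (Int.cast_pos (R := ℝ)).2 h
  push_cast at h'
  rw [sum_sum_pairExponent, sum_coordExponent]
  refine pos_of_mul_pos_right (a := (r : ℝ)) ?_ hR.le
  have h2 : (0 : ℝ) < 2 := by norm_num
  convert mul_pos h2 h' using 1
  field_simp
  ring

end Exponents

/-! ### Signed classes modulo a subspace and the rank count -/

/-- The coordinate functional `x_i` on `ℝ^N`. -/
abbrev coordForm {N : ℕ} (i : Fin N) : Module.Dual ℝ (Fin N → ℝ) :=
  LinearMap.proj i

/-- Evaluating these forms at the basis vectors indexed by `I` gives the identity matrix, because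
each correction term involves a coordinate outside `I`. -/
theorem card_le_finrank_of_coordForm_add_smul_mem {N : ℕ}
    (W : Submodule ℝ (Module.Dual ℝ (Fin N → ℝ))) (I : Finset (Fin N)) (ε : Fin N → ℝ)
    (ρ : Fin N → Fin N) (hW : ∀ i ∈ I, coordForm i + ε i • coordForm (ρ i) ∈ W)
    (hρ : ∀ i ∈ I, ε i ≠ 0 → ρ i ∉ I) : I.card ≤ Module.finrank ℝ W := by
  let v : I → W := fun i => ⟨coordForm i + ε i • coordForm (ρ i), hW i i.2⟩
  have hv : LinearIndependent ℝ v := by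
    let φ : W →ₗ[ℝ] (I → ℝ) :=
      LinearMap.pi fun j => (Module.Dual.eval ℝ _ (Pi.single (j : Fin N) 1)) ∘ₗ W.subtype
    apply LinearIndependent.of_comp φ
    have : φ ∘ v = fun i => Pi.single i (1 : ℝ) := by
      ext i j
      have h0 : ε i * (Pi.single (j : Fin N) (1 : ℝ) : Fin N → ℝ) (ρ i) = 0 := by
        by_cases h : ε i = 0
        · rw [h, zero_mul]
        · have : ρ i ≠ j := fun h' => hρ i i.2 h (h' ▸ j.2)
          rw [Pi.single_eq_of_ne this, mul_zero]
      simp only [φ, v, Function.comp_apply, LinearMap.pi_apply, LinearMap.comp_apply,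
        Submodule.subtype_apply, Module.Dual.eval_apply, LinearMap.add_apply,
        LinearMap.smul_apply, LinearMap.proj_apply, smul_eq_mul, h0, add_zero]
      simp only [Pi.single_apply, Subtype.ext_iff, eq_comm (a := (j : Fin N))]
    rw [this]
    have := (Pi.basisFun ℝ I).linearIndependent
    convert this using 1
    ext i : 1
    simp
  simpa using hv.fintype_card_le_finrank

section Classes

variable {N : ℕ} (W : Submodule ℝ (Module.Dual ℝ (Fin N → ℝ)))

/-- The equivalence relation `x_i = ± x_j` modulo `W`. -/
def signedSetoid : Setoid (Fin N) where
  r i j := coordForm i - coordForm j ∈ W ∨ coordForm i + coordForm j ∈ W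
  iseqv :=
    { refl := fun i => Or.inl (by simp)
      symm := by
        rintro i j (h | h)
        · left
          simpa using W.neg_mem h
        · right
          rwa [add_comm]
      trans := by
        rintro i j k (h | h) (h' | h')
        · left
          simpa using W.add_mem h h'
        · right
          convert W.add_mem h h' using 1
          abel
        · right
          convert W.sub_mem h h' using 1
          abel
        · left
          convert W.sub_mem h h' using 1
          abel }

theorem coordForm_mem_iff_of_signed {i j : Fin N}
    (h : coordForm i - coordForm j ∈ W ∨ coordForm i + coordForm j ∈ W) :
    coordForm i ∈ W ↔ coordForm j ∈ W := by
  rcases h with h | h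
  · constructor
    · intro hi
      simpa using W.sub_mem hi h
    · intro hj
      simpa using W.add_mem h hj
  · constructor
    · intro hi
      simpa using W.sub_mem h hi
    · intro hj
      simpa using W.sub_mem h hj

theorem coordForm_mem_of_sub_of_add {i j : Fin N} (h : coordForm i - coordForm j ∈ W)
    (h' : coordForm i + coordForm j ∈ W) : coordForm i ∈ W := by
  have h2 := W.smul_mem (1 / 2 : ℝ) (W.add_mem h h')
  have h3 : (coordForm i - coordForm j) + (coordForm i + coordForm j) =
      (2 : ℝ) • coordForm i := by
    rw [two_smul]; abel
  rwa [h3, smul_smul, one_div, inv_mul_cancel₀ two_ne_zero, one_smul] at h2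

open Classical in
theorem exponents_pos {ι : Type*} [Fintype ι] [DecidableEq ι] (c : Fin N → ι) (T : Finset ι)
    {r s : ℕ} (hr : Fintype.card ι + 1 = r) (hs : s + T.card = Fintype.card ι) (hW : W ≠ ⊥) :
    0 < (Module.finrank ℝ W : ℝ) +
      ((∑ i, ∑ j, if coordForm i - coordForm j ∈ W then pairExponent c r i j else 0) +
        (∑ i, ∑ j, if coordForm i + coordForm j ∈ W then pairExponent c r i j else 0) +
        ∑ i, if coordForm i ∈ W then coordExponent c T r s i else 0) := by
  let σ := signedSetoid W
  let rep : Fin N → Fin N := fun i => (Quotient.mk σ i).out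
  have hrep : ∀ i j, rep i = rep j ↔
      (coordForm i - coordForm j ∈ W ∨ coordForm i + coordForm j ∈ W) := fun i j =>
    Quotient.out_inj.trans (Quotient.eq (r := σ))
  have hrr : ∀ i, rep (rep i) = rep i := fun i =>
    congrArg Quotient.out (Quotient.out_eq (Quotient.mk σ i))
  have hZ : ∀ i j, rep i = rep j → (coordForm i ∈ W ↔ coordForm j ∈ W) := fun i j h =>
    coordForm_mem_iff_of_signed W ((hrep i j).1 h)
  let A : Fin N → Finset (Fin N) := fun ρ => Finset.univ.filter fun i => rep i = ρ
  have hA : ∀ ρ i, i ∈ A ρ ↔ rep i = ρ := fun ρ i => by simp [A]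
  have hAZ : ∀ ρ, ∀ i ∈ A ρ, (coordForm i ∈ W ↔ coordForm ρ ∈ W) := fun ρ i hi => by
    apply hZ
    rw [← (hA ρ i).1 hi, hrr]
  -- Within a class inside `W` both signs occur; otherwise exactly one does, since both together
  -- would force `x_i ∈ W`.
  have hpair : ∀ i j, ((if coordForm i - coordForm j ∈ W then pairExponent c r i j else 0) +
      if coordForm i + coordForm j ∈ W then pairExponent c r i j else 0) =
      if rep j = rep i then (if coordForm i ∈ W then 2 else 1) * pairExponent c r i j else 0 := by
    intro i j
    by_cases hij : i = j
    · simp [hij, pairExponent]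
    by_cases h : rep i = rep j
    · rw [if_pos h.symm]
      by_cases hi : coordForm i ∈ W
      · have hj := (hZ i j h).1 hi
        rw [if_pos (W.sub_mem hi hj), if_pos (W.add_mem hi hj), if_pos hi, two_mul]
      · rw [if_neg hi]
        rcases (hrep i j).1 h with h1 | h1
        · rw [if_pos h1, if_neg fun h2 => hi (coordForm_mem_of_sub_of_add W h1 h2)]
          ring
        · rw [if_pos h1, if_neg fun h2 => hi (coordForm_mem_of_sub_of_add W h2 h1)]
          ring
    · have h1 := mt (hrep i j).2 h
      push Not at h1
      rw [if_neg h1.1, if_neg h1.2, if_neg fun h' => h h'.symm, add_zero]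
  -- `I` omits only the representatives of the classes outside `W`, so its size is the lower bound
  -- for the rank.
  let I : Finset (Fin N) := Finset.univ.filter fun i => coordForm i ∈ W ∨ rep i ≠ i
  have hI : I.card ≤ Module.finrank ℝ W := by
    have hsgn : ∀ i, ∃ ε : ℝ, (coordForm i ∈ W ∨ rep i ≠ i →
        coordForm i + ε • coordForm (rep i) ∈ W) ∧ (ε ≠ 0 → coordForm i ∉ W) := by
      intro i
      by_cases hi : coordForm i ∈ W
      · exact ⟨0, fun _ => by simpa using hi, by simp⟩
      · rcases (hrep i (rep i)).1 (hrr i).symm with h | h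
        · exact ⟨-1, fun _ => by
            convert h using 1
            exact LinearMap.ext fun y => by simp [sub_eq_add_neg], fun _ => hi⟩
        · exact ⟨1, fun _ => by simpa using h, fun _ => hi⟩
    choose ε hε1 hε2 using hsgn
    refine card_le_finrank_of_coordForm_add_smul_mem W I ε rep
      (fun i hi => hε1 i (Finset.mem_filter.1 hi).2) fun i hi h0 hmem => ?_
    rcases (Finset.mem_filter.1 hmem).2 with h | h
    · exact hε2 i h0 ((hZ _ _ (hrr i)).1 h)
    · exact h (hrr i)
  -- The contribution of one class, rank plus exponents; it is zero when `ρ` is not a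
  -- representative.
  let t : Fin N → ℝ := fun ρ => ((I.filter fun i => rep i = ρ).card : ℝ) +
    ((if coordForm ρ ∈ W then 2 else 1) * ∑ i ∈ A ρ, ∑ j ∈ A ρ, pairExponent c r i j +
      if coordForm ρ ∈ W then ∑ i ∈ A ρ, coordExponent c T r s i else 0)
  have hIcard : (I.card : ℝ) = ∑ ρ, ((I.filter fun i => rep i = ρ).card : ℝ) := by
    rw [← Nat.cast_sum, Nat.cast_inj]
    exact Finset.card_eq_sum_card_fiberwise fun _ _ => Finset.mem_univ _
  have hsplit : (∑ i, ∑ j, if coordForm i - coordForm j ∈ W then pairExponent c r i j else 0) +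
      (∑ i, ∑ j, if coordForm i + coordForm j ∈ W then pairExponent c r i j else 0) =
      ∑ ρ, (if coordForm ρ ∈ W then 2 else 1) * ∑ i ∈ A ρ, ∑ j ∈ A ρ, pairExponent c r i j := by
    rw [← Finset.sum_add_distrib]
    simp only [← Finset.sum_add_distrib, hpair]
    rw [← Finset.sum_fiberwise Finset.univ rep]
    refine Finset.sum_congr rfl fun ρ _ => ?_
    rw [Finset.mul_sum]
    refine Finset.sum_congr rfl fun i hi => ?_
    rw [← Finset.sum_filter, Finset.mul_sum, (hA ρ i).1 hi]
    refine Finset.sum_congr rfl fun j _ => ?_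
    simp only [hAZ ρ i hi]
  have hcoord : (∑ i, if coordForm i ∈ W then coordExponent c T r s i else 0) =
      ∑ ρ, if coordForm ρ ∈ W then ∑ i ∈ A ρ, coordExponent c T r s i else 0 := by
    rw [← Finset.sum_fiberwise Finset.univ rep]
    refine Finset.sum_congr rfl fun ρ _ => ?_
    split_ifs with h
    · exact Finset.sum_congr rfl fun i hi => if_pos ((hAZ ρ i hi).2 h)
    · exact Finset.sum_eq_zero fun i hi => if_neg (mt (hAZ ρ i hi).1 h)
  have htotal : (I.card : ℝ) +
      ((∑ i, ∑ j, if coordForm i - coordForm j ∈ W then pairExponent c r i j else 0) +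
        (∑ i, ∑ j, if coordForm i + coordForm j ∈ W then pairExponent c r i j else 0) +
        ∑ i, if coordForm i ∈ W then coordExponent c T r s i else 0) = ∑ ρ, t ρ := by
    rw [hsplit, hcoord, hIcard, ← Finset.sum_add_distrib, ← Finset.sum_add_distrib]
  have htZ : ∀ ρ, coordForm ρ ∈ W → (A ρ).Nonempty → 0 < t ρ := by
    intro ρ hρ hne
    have hcard : I.filter (fun i => rep i = ρ) = A ρ := by
      ext i
      simp only [I, Finset.mem_filter, Finset.mem_univ, true_and, hA]
      exact ⟨fun h => h.2, fun h => ⟨Or.inl ((hAZ ρ i ((hA ρ i).2 h)).2 hρ), h⟩⟩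
    have := zero_class_exponent_pos c T hr hs (A ρ) hne
    simp only [t, hcard, if_pos hρ]
    linarith
  have htA : ∀ ρ, coordForm ρ ∉ W → (A ρ).Nonempty →
      t ρ = ((A ρ).card : ℝ) - 1 + ∑ i ∈ A ρ, ∑ j ∈ A ρ, pairExponent c r i j := by
    intro ρ hρ hne
    have hρmem : ρ ∈ A ρ := by
      obtain ⟨i, hi⟩ := hne
      rw [hA] at hi ⊢
      rw [← hi, hrr]
    have hcard : I.filter (fun i => rep i = ρ) = (A ρ).erase ρ := by
      ext i
      simp only [I, Finset.mem_filter, Finset.mem_univ, true_and, Finset.mem_erase, hA]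
      constructor
      · rintro ⟨h | h, h'⟩
        · exact absurd ((hAZ ρ i ((hA ρ i).2 h')).1 h) hρ
        · exact ⟨fun h2 => h (h'.trans h2.symm), h'⟩
      · rintro ⟨h, h'⟩
        exact ⟨Or.inr fun h2 => h (h2.symm.trans h'), h'⟩
    simp only [t, hcard, if_neg hρ, one_mul, add_zero]
    rw [Finset.card_erase_of_mem hρmem, Nat.cast_sub (Finset.card_pos.2 ⟨ρ, hρmem⟩), Nat.cast_one]
  have htone : ∀ ρ, (A ρ).card ≤ 1 → ∑ i ∈ A ρ, ∑ j ∈ A ρ, pairExponent c r i j = 0 := by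
    intro ρ hρ
    refine Finset.sum_eq_zero fun i hi => Finset.sum_eq_zero fun j hj => ?_
    rw [Finset.card_le_one.1 hρ i hi j hj, pairExponent, if_pos rfl]
  have htempty : ∀ ρ, ¬ (A ρ).Nonempty → t ρ = 0 := by
    intro ρ hρ
    have h0 := Finset.not_nonempty_iff_eq_empty.1 hρ
    have hcard : I.filter (fun i => rep i = ρ) = ∅ := by
      rw [← Finset.subset_empty, ← h0]
      exact fun i hi => (hA ρ i).2 (Finset.mem_filter.1 hi).2
    simp [t, h0, hcard]
  have htnonneg : ∀ ρ, 0 ≤ t ρ := by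
    intro ρ
    by_cases hne : (A ρ).Nonempty
    · by_cases hρ : coordForm ρ ∈ W
      · exact (htZ ρ hρ hne).le
      · rw [htA ρ hρ hne]
        rcases le_or_gt (A ρ).card 1 with h1 | h1
        · have : (A ρ).card = 1 := le_antisymm h1 hne.card_pos
          rw [htone ρ h1, this]
          simp
        · exact (class_exponent_pos c hr (A ρ) h1).le
    · exact (htempty ρ hne).ge
  have hIR : (I.card : ℝ) ≤ Module.finrank ℝ W := by exact_mod_cast hI
  by_cases hpos : ∃ ρ, 0 < t ρ
  · obtain ⟨ρ, hρ⟩ := hpos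
    have : 0 < ∑ ρ, t ρ := Finset.sum_pos' (fun ρ _ => htnonneg ρ) ⟨ρ, Finset.mem_univ _, hρ⟩
    linarith
  -- Every class is now a singleton outside `W`, so no exponent contributes and strict positivity
  -- comes from `dim W > 0` alone.
  · push Not at hpos
    have hcoord0 : (∑ i, if coordForm i ∈ W then coordExponent c T r s i else 0) = 0 := by
      refine Finset.sum_eq_zero fun i _ => if_neg fun hi => ?_
      have hi' : coordForm (rep i) ∈ W := (hZ _ _ (hrr i)).2 hi
      exact absurd (htZ (rep i) hi' ⟨i, (hA _ _).2 rfl⟩) (hpos _).not_gt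
    have hsmall : ∀ ρ, (A ρ).card ≤ 1 := by
      intro ρ
      by_contra! h1
      have hne : (A ρ).Nonempty := Finset.card_pos.1 (by omega)
      by_cases hρ : coordForm ρ ∈ W
      · exact absurd (htZ ρ hρ hne) (hpos _).not_gt
      · have := class_exponent_pos c hr (A ρ) h1
        rw [← htA ρ hρ hne] at this
        exact absurd this (hpos _).not_gt
    have hfin : (0 : ℝ) < Module.finrank ℝ W := by
      rw [Nat.cast_pos]
      exact Nat.pos_of_ne_zero fun h => hW (Submodule.finrank_eq_zero.1 h)
    rw [hcoord0, hsplit, Finset.sum_eq_zero fun ρ _ => by rw [htone ρ (hsmall ρ), mul_zero]]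
    linarith

end Classes

/-! ### The weight built from `x_i ± x_j` and `x_i` -/

section Weight

variable {N : ℕ}

/-- The linear forms `x_i - x_j`, `x_i + x_j` and `x_i`. -/
def signedForms (N : ℕ) :
    (Fin N × Fin N) ⊕ ((Fin N × Fin N) ⊕ Fin N) → Module.Dual ℝ (Fin N → ℝ) :=
  Sum.elim (fun p => coordForm p.1 - coordForm p.2)
    (Sum.elim (fun p => coordForm p.1 + coordForm p.2) coordForm)

/-- The exponents of the forms in `signedForms`. -/
noncomputable def signedExponents {ι : Type*} [DecidableEq ι] (c : Fin N → ι) (T : Finset ι)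
    (r s : ℕ) : (Fin N × Fin N) ⊕ ((Fin N × Fin N) ⊕ Fin N) → ℝ :=
  Sum.elim (fun p => pairExponent c r p.1 p.2)
    (Sum.elim (fun p => pairExponent c r p.1 p.2) (coordExponent c T r s))

/-- Indexing by ordered pairs absorbs the square in `|g|^2` but includes the diagonal, where `x_i -
x_i = 0`; the exponent there is set to `0`. -/
theorem signedExponents_eq_zero_of_form_eq_zero {ι : Type*} [DecidableEq ι] (c : Fin N → ι)
    (T : Finset ι) (r s : ℕ) (h : (Fin N × Fin N) ⊕ ((Fin N × Fin N) ⊕ Fin N))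
    (h0 : signedForms N h = 0) : signedExponents c T r s h = 0 := by
  rcases h with ⟨i, j⟩ | ⟨i, j⟩ | i
  · by_cases hij : i = j
    · simp [signedExponents, pairExponent, hij]
    · have := LinearMap.congr_fun h0 (Pi.single i 1)
      simp [signedForms, Ne.symm hij] at this
  · have := LinearMap.congr_fun h0 (Pi.single i 1)
    by_cases hij : j = i <;> simp [signedForms, hij] at this
  · have := LinearMap.congr_fun h0 (Pi.single i 1)
    simp [signedForms] at this

theorem linearFormsWeight_signedForms {ι : Type*} [DecidableEq ι] (c : Fin N → ι)
    (T : Finset ι) (r s : ℕ) (x : Fin N → ℝ) :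
    linearFormsWeight (signedForms N) (signedExponents c T r s) Finset.univ x =
      (∏ i, ∏ j, |x i ^ 2 - x j ^ 2| ^ pairExponent c r i j) *
        ∏ i, |x i| ^ coordExponent c T r s i := by
  have h : ∀ i j, |x i ^ 2 - x j ^ 2| ^ pairExponent c r i j =
      |x i - x j| ^ pairExponent c r i j * |x i + x j| ^ pairExponent c r i j := by
    intro i j
    rw [← Real.mul_rpow (abs_nonneg _) (abs_nonneg _), ← abs_mul]
    congr 2
    ring
  simp only [h, Finset.prod_mul_distrib]
  rw [linearFormsWeight, Fintype.prod_sum_type, Fintype.prod_sum_type, Fintype.prod_prod_type,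
    Fintype.prod_prod_type, mul_assoc]
  rfl

theorem exists_nhds_lintegral_signedForms_lt_top {ι : Type*} [Fintype ι] [DecidableEq ι]
    (c : Fin N → ι) (T : Finset ι) {r s : ℕ} (hr : Fintype.card ι + 1 = r)
    (hs : s + T.card = Fintype.card ι) (p : Fin N → ℝ) :
    ∃ U ∈ 𝓝 p, ∫⁻ x in U, ENNReal.ofReal
      (linearFormsWeight (signedForms N) (signedExponents c T r s) Finset.univ x) < ⊤ := by
  refine exists_nhds_lintegral_linearFormsWeight_lt_top
    (signedExponents_eq_zero_of_form_eq_zero c T r s) _ (fun W _ hW => ?_) p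
  convert exponents_pos W c T hr hs hW using 2
  rw [Finset.sum_filter, Fintype.sum_sum_type, Fintype.sum_sum_type, Fintype.sum_prod_type,
    Fintype.sum_prod_type, ← add_assoc]
  congr!

end Weight

/-! ### Blocks as colourings and the modulus of a generator -/

theorem sq_prod_prod_filter_lt {N : ℕ} (u : Fin N → Fin N → ℝ) (hu : ∀ i j, u i j = u j i) :
    (∏ i, ∏ j with i < j, u i j) ^ 2 = ∏ i, ∏ j, if i = j then 1 else u i j := by
  have h : ∏ i, ∏ j with i < j, u i j = ∏ i, ∏ j with j < i, u i j := by
    simp only [Finset.prod_filter]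
    rw [Finset.prod_comm]
    simp only [hu]
  rw [sq]
  nth_rw 2 [h]
  simp only [Finset.prod_filter, ← Finset.prod_mul_distrib]
  refine Finset.prod_congr rfl fun i _ => Finset.prod_congr rfl fun j _ => ?_
  rcases lt_trichotomy i j with h | h | h
  · simp [h, h.ne, h.not_gt]
  · simp [h]
  · simp [h, h.ne', h.not_gt]

theorem sum_balancedPartition (N : ℕ) {k : ℕ} (hk : 0 < k) : ∑ j, balancedPartition N k j = N := by
  have h : ∀ j, balancedPartition N k j = N / k + if (j : ℕ) < N % k then 1 else 0 := by
    intro j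
    unfold balancedPartition
    split_ifs <;> rfl
  simp only [h, Finset.sum_add_distrib, Finset.sum_const, Finset.card_univ, Fintype.card_fin,
    smul_eq_mul]
  rw [← Finset.card_filter, Fin.card_filter_val_lt, min_eq_right (Nat.mod_lt N hk).le,
    Nat.div_add_mod]

theorem card_lastLabels {k m : ℕ} (hm : m ≤ k) : (lastLabels k m).card = m := by
  have h : lastLabels k m = Finset.univ.filter fun j : Fin k => ¬ (j : ℕ) < k - m := by
    ext j
    simp only [lastLabels, Finset.mem_filter, Finset.mem_univ, true_and]
    omega
  rw [h]
  have := Finset.card_filter_add_card_filter_not (s := (Finset.univ : Finset (Fin k)))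
    fun j : Fin k => (j : ℕ) < k - m
  rw [Fin.card_filter_val_lt, Finset.card_univ, Fintype.card_fin] at this
  omega

theorem exists_colouring_of_blocks {N k : ℕ} (ν : Fin k → ℕ) (hν : ∑ j, ν j = N) :
    ∃ c : Fin N → Fin k, ∀ i j, i ∈ blockOf N ν j ↔ c i = j := by
  have hex : ∀ i : Fin N, ∃ j, i ∈ blockOf N ν j := by
    intro i
    have hne : (Finset.univ.filter fun j : Fin k => (i : ℕ) < ∑ l ∈ Finset.Iic j, ν l).Nonempty := by
      rcases k with _ | k
      · have := i.2
        simp at hν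
        omega
      · refine ⟨Fin.last k, ?_⟩
        have : Finset.Iic (Fin.last k) = Finset.univ := by ext; simp [Fin.le_last]
        simp [this, hν]
    obtain ⟨j, hj, hmin⟩ := Finset.exists_min_image _ id hne
    have hj := (Finset.mem_filter.1 hj).2
    -- `j` is the first label whose cumulative sum exceeds `i`; were the lower bound to fail, its
    -- predecessor would already qualify.
    refine ⟨j, ?_⟩
    simp only [blockOf, Finset.mem_filter, Finset.mem_univ, true_and]
    refine ⟨?_, hj⟩
    by_contra! hlt
    rcases (Finset.Iio j).eq_empty_or_nonempty with h0 | h0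
    · rw [h0] at hlt
      simp at hlt
    · set j' := (Finset.Iio j).max' h0
      have hj' : j' < j := Finset.mem_Iio.1 (Finset.max'_mem _ h0)
      have hIic : Finset.Iic j' = Finset.Iio j := by
        ext l
        simp only [Finset.mem_Iic, Finset.mem_Iio]
        exact ⟨fun h => h.trans_lt hj', fun h => Finset.le_max' _ _ (Finset.mem_Iio.2 h)⟩
      exact (hmin j' (by simp [hIic, hlt])).not_gt hj'
  have huniq : ∀ (i : Fin N) (j j' : Fin k), i ∈ blockOf N ν j → i ∈ blockOf N ν j' →
      j' ≤ j := by
    intro i j j' h h'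
    simp only [blockOf, Finset.mem_filter, Finset.mem_univ, true_and] at h h'
    by_contra! hlt
    have : ∑ l ∈ Finset.Iic j, ν l ≤ ∑ l ∈ Finset.Iio j', ν l :=
      Finset.sum_le_sum_of_subset fun l hl =>
        Finset.mem_Iio.2 ((Finset.mem_Iic.1 hl).trans_lt hlt)
    omega
  choose c hc using hex
  exact ⟨c, fun i j => ⟨fun h => le_antisymm (huniq i _ _ h (hc i)) (huniq i _ _ (hc i) h),
    fun h => h ▸ hc i⟩⟩

theorem eval_pPolyB {N k : ℕ} (ν : Fin k → ℕ) (T : Finset (Fin k)) {c : Fin N → Fin k}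
    (hc : ∀ i j, i ∈ blockOf N ν j ↔ c i = j) (y : Fin N → ℂ) :
    MvPolynomial.eval y (pPolyB N ν T) =
      (∏ i, ∏ j with i < j, if c i = c j then y i ^ 2 - y j ^ 2 else 1) *
        ∏ i, if c i ∈ T then y i else 1 := by
  have hblock : ∀ j, blockOf N ν j = Finset.univ.filter fun i => c i = j := by
    intro j
    ext i
    simp [hc]
  have hbind : MvPolynomial.eval y (MvPolynomial.bind₁
      (fun i => (MvPolynomial.X i : MvPolynomial (Fin N) ℂ) ^ 2) (pPoly N ν)) =
      MvPolynomial.eval (fun i => y i ^ 2) (pPoly N ν) := by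
    rw [← MvPolynomial.coe_aeval_eq_eval, ← MvPolynomial.coe_aeval_eq_eval]
    simp only [RingHom.coe_coe]
    rw [MvPolynomial.aeval_bind₁]
    simp
  rw [pPolyB, map_mul, hbind]
  congr 1
  · simp only [pPoly, vandermondeOn, map_prod, map_sub, MvPolynomial.eval_X, hblock]
    rw [← Finset.prod_fiberwise Finset.univ c]
    refine Finset.prod_congr rfl fun u _ => Finset.prod_congr rfl fun i hi => ?_
    rw [← Finset.prod_filter, Finset.filter_filter, Finset.filter_filter]
    refine Finset.prod_congr ?_ fun _ _ => rfl
    ext j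
    simp only [Finset.mem_filter, Finset.mem_univ, true_and] at hi ⊢
    rw [hi, and_comm, eq_comm]
  · simp only [map_prod, MvPolynomial.eval_X, hblock]
    rw [← Finset.prod_filter, ← Finset.prod_fiberwise_of_maps_to (s := Finset.univ.filter
      fun i => c i ∈ T) (t := T) (g := c) (by simp)]
    refine Finset.prod_congr rfl fun u hu => Finset.prod_congr ?_ fun _ _ => rfl
    ext i
    simp only [Finset.mem_filter, Finset.mem_univ, true_and]
    exact ⟨fun h => ⟨h ▸ hu, h⟩, fun h => h.2⟩

theorem norm_eval_rename_pPolyB_sq {N k : ℕ} (ν : Fin k → ℕ) (T : Finset (Fin k))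
    {c : Fin N → Fin k} (hc : ∀ i j, i ∈ blockOf N ν j ↔ c i = j) (σ : Equiv.Perm (Fin N))
    (x : Fin N → ℝ) :
    ‖MvPolynomial.eval (fun i => (x i : ℂ)) (MvPolynomial.rename σ (pPolyB N ν T))‖ ^ 2 =
      (∏ i, ∏ j, if i = j then 1 else
        if c (σ.symm i) = c (σ.symm j) then |x i ^ 2 - x j ^ 2| else 1) *
        ∏ i, if c (σ.symm i) ∈ T then |x i| ^ 2 else 1 := by
  rw [MvPolynomial.eval_rename, eval_pPolyB ν T hc, norm_mul, mul_pow]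
  simp only [norm_prod]
  congr 1
  · have h : ∀ i j, ‖if c i = c j then (((fun i => (x i : ℂ)) ∘ σ) i) ^ 2 -
        (((fun i => (x i : ℂ)) ∘ σ) j) ^ 2 else 1‖ =
        if c i = c j then |x (σ i) ^ 2 - x (σ j) ^ 2| else 1 := by
      intro i j
      split_ifs
      · rw [← Real.norm_eq_abs, ← Complex.norm_real]
        push_cast
        rfl
      · exact norm_one
    simp only [h]
    rw [sq_prod_prod_filter_lt _ fun i j => by simp only [eq_comm, abs_sub_comm],
      ← Equiv.prod_comp σ fun i => ∏ j, if i = j then (1 : ℝ) else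
        if c (σ.symm i) = c (σ.symm j) then |x i ^ 2 - x j ^ 2| else 1]
    exact Finset.prod_congr rfl fun i _ => Fintype.prod_equiv σ _ _ fun j => by simp
  · rw [← Finset.prod_pow, ← Equiv.prod_comp σ fun i =>
      if c (σ.symm i) ∈ T then |x i| ^ 2 else (1 : ℝ)]
    refine Finset.prod_congr rfl fun i _ => ?_
    simp only [Equiv.symm_apply_apply, Function.comp_apply]
    split_ifs <;> simp

theorem norm_quotientB_sq {N : ℕ} (f : MvPolynomial (Fin N) ℂ) (a b : ℝ) (x : Fin N → ℝ) :
    ‖quotientB f a b x‖ ^ 2 = ‖MvPolynomial.eval (fun i => (x i : ℂ)) f‖ ^ 2 /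
      ((∏ i, ∏ j, if i = j then 1 else |x i ^ 2 - x j ^ 2| ^ a) * ∏ i, (|x i| ^ b) ^ 2) := by
  have h : ∀ i j, ‖((x i : ℂ) ^ 2 - (x j : ℂ) ^ 2) ^ (a : ℂ)‖ = |x i ^ 2 - x j ^ 2| ^ a := by
    intro i j
    rw [Complex.norm_cpow_real, ← Real.norm_eq_abs, ← Complex.norm_real]
    push_cast
    rfl
  rw [quotientB, norm_div, div_pow, norm_mul, mul_pow]
  simp only [norm_prod, h, Complex.norm_cpow_real, Complex.norm_real, Real.norm_eq_abs]
  rw [sq_prod_prod_filter_lt _ fun i j => by rw [abs_sub_comm], Finset.prod_pow]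

theorem norm_quotientB_rename_pPolyB_sq {N k : ℕ} (ν : Fin k → ℕ) (T : Finset (Fin k))
    {c : Fin N → Fin k} (hc : ∀ i j, i ∈ blockOf N ν j ↔ c i = j) (σ : Equiv.Perm (Fin N))
    {r : ℕ} (hr : 2 ≤ r) (s : ℕ) (x : Fin N → ℝ) :
    ‖quotientB (MvPolynomial.rename σ (pPolyB N ν T)) (1 / (r : ℝ))
      (1 / 2 - (s : ℝ) / (r : ℝ)) x‖ ^ 2 =
      linearFormsWeight (signedForms N) (signedExponents (c ∘ σ.symm) T r s) Finset.univ x := by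
  have hrR : (2 : ℝ) ≤ r := by exact_mod_cast hr
  rw [norm_quotientB_sq, norm_eval_rename_pPolyB_sq ν T hc, linearFormsWeight_signedForms,
    mul_div_mul_comm]
  simp only [← Finset.prod_div_distrib]
  congr 1
  · refine Finset.prod_congr rfl fun i _ => Finset.prod_congr rfl fun j _ => ?_
    set d := |x i ^ 2 - x j ^ 2|
    have hd : 0 ≤ d := abs_nonneg _
    simp only [pairExponent, Function.comp_apply]
    split_ifs with h1 h2
    · simp
    -- A nonzero resulting exponent makes the quotient rule for powers valid at `d = 0` too, so the
    -- identity holds everywhere, not just almost everywhere.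
    · have h : (1 : ℝ) - 1 / r ≠ 0 := by
        have : 1 / (r : ℝ) ≤ 1 / 2 := one_div_le_one_div_of_le two_pos hrR
        linarith
      rw [Real.rpow_sub' hd h, Real.rpow_one]
    · rw [zero_sub, Real.rpow_neg hd, one_div (d ^ _)]
  · refine Finset.prod_congr rfl fun i _ => ?_
    have hd : 0 ≤ |x i| := abs_nonneg _
    have hb : (|x i| ^ (1 / 2 - (s : ℝ) / r)) ^ 2 = |x i| ^ (1 - 2 * s / r : ℝ) := by
      rw [← Real.rpow_natCast, ← Real.rpow_mul hd]
      congr 1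
      push_cast
      ring
    rw [hb]
    simp only [coordExponent, Function.comp_apply]
    split_ifs with h
    · have h0 : (2 : ℝ) - (1 - 2 * s / r) ≠ 0 := by
        have : 0 ≤ 2 * (s : ℝ) / r := by positivity
        linarith
      rw [Real.rpow_sub' hd h0, Real.rpow_two]
    · rw [zero_sub, Real.rpow_neg hd, one_div]

/-! ### Passage from generators to the ideal -/

theorem measurable_quotientB {N : ℕ} (f : MvPolynomial (Fin N) ℂ) (a b : ℝ) :
    Measurable (quotientB f a b) := by
  have hf : Measurable fun x : Fin N → ℝ => MvPolynomial.eval (fun i => (x i : ℂ)) f :=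
    ((MvPolynomial.continuous_eval f).comp (by fun_prop)).measurable
  refine hf.div (Measurable.mul ?_ ?_)
  · exact Finset.measurable_prod _ fun i _ => Finset.measurable_prod _ fun j _ => by fun_prop
  · exact Finset.measurable_prod _ fun i _ => by fun_prop

theorem locallyL2_of_lintegral_norm_sq {N : ℕ} {g : (Fin N → ℝ) → ℂ} (hg : Measurable g)
    (h : ∀ p, ∃ U ∈ 𝓝 p, ∫⁻ x in U, ENNReal.ofReal (‖g x‖ ^ 2) < ⊤) : LocallyL2 g := by
  intro p
  obtain ⟨U, hU, hfin⟩ := h p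
  refine ⟨U, hU, (memLp_two_iff_integrable_sq_norm hg.aestronglyMeasurable).2
    ⟨(hg.norm.pow_const 2).aestronglyMeasurable, ?_⟩⟩
  rwa [hasFiniteIntegral_iff_ofReal (Filter.Eventually.of_forall fun x => sq_nonneg _)]

theorem LocallyL2.add {N : ℕ} {g g' : (Fin N → ℝ) → ℂ} (h : LocallyL2 g) (h' : LocallyL2 g') :
    LocallyL2 (g + g') := by
  intro p
  obtain ⟨U, hU, hg⟩ := h p
  obtain ⟨U', hU', hg'⟩ := h' p
  exact ⟨U ∩ U', Filter.inter_mem hU hU',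
    (hg.mono_measure (Measure.restrict_mono_set _ Set.inter_subset_left)).add
      (hg'.mono_measure (Measure.restrict_mono_set _ Set.inter_subset_right))⟩

/-- A continuous factor is bounded near each point; applied to polynomial multipliers, this handles
the coefficients of ideal elements. -/
theorem LocallyL2.continuous_mul {N : ℕ} {u g : (Fin N → ℝ) → ℂ} (hu : Continuous u)
    (h : LocallyL2 g) : LocallyL2 (u * g) := by
  intro p
  obtain ⟨U, hU, hg⟩ := h p
  have hbd : ∀ᶠ x in 𝓝 p, ‖u x‖ < ‖u p‖ + 1 :=
    hu.norm.continuousAt.eventually_lt_const (lt_add_one _)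
  obtain ⟨V, hV, hVo, hpV⟩ := eventually_nhds_iff.1 hbd
  have hgV := hg.restrict V
  rw [Measure.restrict_restrict hVo.measurableSet] at hgV
  refine ⟨V ∩ U, Filter.inter_mem (hVo.mem_nhds hpV) hU,
    hgV.of_le_mul (c := ‖u p‖ + 1) (hu.aestronglyMeasurable.mul hgV.1) ?_⟩
  rw [← Measure.restrict_restrict hVo.measurableSet]
  filter_upwards [ae_restrict_mem hVo.measurableSet] with x hx
  rw [Pi.mul_apply, norm_mul]
  exact mul_le_mul_of_nonneg_right (hV x hx).le (norm_nonneg _)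

theorem mainTheorem4 (N r s : ℕ) (hr : 2 ≤ r) (hrN : r ≤ N) (hs : s ≤ r - 1)
    (f : MvPolynomial (Fin N) ℂ) (hf : f ∈ idealK N (r - 1) (r - s - 1)) :
    LocallyL2 (quotientB f (1 / (r : ℝ)) (1 / 2 - (s : ℝ) / (r : ℝ))) := by
  obtain ⟨c, hc⟩ := exists_colouring_of_blocks (balancedPartition N (r - 1))
    (sum_balancedPartition N (by omega))
  have hT : (lastLabels (r - 1) (r - s - 1)).card = r - s - 1 := card_lastLabels (by omega)
  rw [idealK, idealOfPartition] at hf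
  induction hf using Submodule.span_induction with
  | mem f hf =>
    obtain ⟨σ, rfl⟩ := hf
    refine locallyL2_of_lintegral_norm_sq (measurable_quotientB _ _ _) fun p => ?_
    simp only [norm_quotientB_rename_pPolyB_sq _ _ hc σ hr s]
    exact exists_nhds_lintegral_signedForms_lt_top _ _ (by rw [Fintype.card_fin]; omega)
      (by rw [Fintype.card_fin, hT]; omega) p
  | zero =>
    refine fun p => ⟨Set.univ, Filter.univ_mem, ?_⟩
    convert MemLp.zero' (p := 2) using 1
    ext x
    simp [quotientB]
  | add f g _ _ hf hg =>
    convert hf.add hg using 1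
    ext x
    simp [quotientB, add_div]
  | smul u f _ hf =>
    convert hf.continuous_mul (u := fun x => MvPolynomial.eval (fun i => (x i : ℂ)) u)
      ((MvPolynomial.continuous_eval u).comp (by fun_prop)) using 1
    ext x
    simp [quotientB, mul_div_assoc]
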